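/- Let $G$ be a compactly generated locally compact (Hausdorff) group with a left Haar measure $\mu$. Let $\Gamma_1,\Gamma_2\le G$ be two uniform lattices, that is, discrete subgroups such that $G/\Gamma_1$ and $G/\Gamma_2$ are compact, and suppose that they have the same covolume: $\mu(G/\Gamma_1)=\mu(G/\Gamma_2)$, where $\mu(G/\Gamma)$ denotes the $\mu$-measure of a fundamental domain for the action of $\Gamma$ on $G$ by right translations. Then $\Gamma_1$ and $\Gamma_2$ are finitely generated and bi-Lipschitz equivalent: for all finite generating sets $S_1$ of $\Gamma_1$ and $S_2$ of $\Gamma_2$, with word metrics $d_{S_1}$ and $d_{S_2}$, there exist a bijection $f:\Gamma_1\to\Gamma_2$ and a constant $K\ge 1$ such that $$K^{-1}\,d_{S_1}(x,y)\le d_{S_2}(f(x),f(y))\le K\,d_{S_1}(x,y)\qquad\text{for all }x,y\in\Gamma_1.$$ -/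

import Mathlib

open MeasureTheory

/-- A topological group is compactly generated if some compact subset generates it
as an abstract group. -/
def IsCompactlyGeneratedGroup (G : Type*) [Group G] [TopologicalSpace G] : Prop :=
  ∃ S : Set G, IsCompact S ∧ Subgroup.closure S = ⊤

/-- A uniform lattice in a topological group `G` is a discrete subgroup `Γ` such that the
quotient space `G ⧸ Γ` of left cosets is compact. -/
structure IsUniformLattice {G : Type*} [Group G] [TopologicalSpace G] (Γ : Subgroup G) : Prop where
  discrete : DiscreteTopology Γ
  cocompact : CompactSpace (G ⧸ Γ)

/-- The covolume of `Γ` in `G` with respect to a measure `μ` on `G`: the `μ`-measure of a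
fundamental domain for the action of `Γ` on `G` by right translations, whose orbits are the
left cosets `g Γ`, i.e. the total mass of the measure induced by `μ` on `G ⧸ Γ`. -/
noncomputable def latticeCovolume {G : Type*} [Group G] [MeasurableSpace G]
    (Γ : Subgroup G) (μ : Measure G) : ENNReal :=
  MeasureTheory.covolume Γ.op G μ

/-- The word distance on a group with respect to a generating set `S`: the graph distance in
the Cayley graph, where `x` and `x * s`, `s ∈ S`, are adjacent. It is left-invariant. -/
noncomputable def wordDist {Γ : Type*} [Group Γ] (S : Set Γ) (x y : Γ) : ℕ :=
  (SimpleGraph.mulCayley S).dist x y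

/-- A bi-Lipschitz bijection from `(Γ, d_S)` to `(Λ, d_T)`. -/
def IsBiLipschitzWord {Γ Λ : Type*} [Group Γ] [Group Λ] (S : Set Γ) (T : Set Λ)
    (f : Γ ≃ Λ) : Prop :=
  ∃ K : ℝ, 1 ≤ K ∧ ∀ x y : Γ,
    K⁻¹ * (wordDist S x y : ℝ) ≤ (wordDist T (f x) (f y) : ℝ) ∧
      (wordDist T (f x) (f y) : ℝ) ≤ K * (wordDist S x y : ℝ)

/-- Two groups are bi-Lipschitz equivalent: both are finitely generated and, for all finite
generating sets, there is a bi-Lipschitz bijection between them for the word distances. -/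
def AreBiLipschitzEquivalent (Γ Λ : Type*) [Group Γ] [Group Λ] : Prop :=
  Group.FG Γ ∧ Group.FG Λ ∧
    ∀ (S : Set Γ) (T : Set Λ), S.Finite → T.Finite →
      Subgroup.closure S = ⊤ → Subgroup.closure T = ⊤ →
        ∃ f : Γ ≃ Λ, IsBiLipschitzWord S T f

/-! Choose bounded Borel transversals `F`, `E` of the two lattices (`exists_isBoundedTransversal`).
A lattice with such a transversal makes `G` unimodular, so right translates of `F` and of `E` all
have the same measure, the common covolume. Join `x : Γ₁` to `y : Γ₂` when `x⁻¹ * y ∈ F⁻¹ * E`, that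
is, when `F x⁻¹` meets `E y⁻¹`. Comparing volumes gives Hall's condition in both directions
(`exists_injective`), and a Schröder–Bernstein argument turns the two injections into a bijection
inside the relation. It moves points by a bounded amount, hence is bi-Lipschitz
(`exists_wordDist_le_mul_of_isCompact`). -/

theorem countable_of_group_fg (Γ : Type*) [Group Γ] [Group.FG Γ] : Countable Γ := by
  obtain ⟨S, hS, φ, hφ⟩ := Group.fg_iff_exists_freeGroup_hom_surjective.1 ‹Group.FG Γ›
  have : Countable S := hS.to_countable
  have : Countable (FreeGroup S) := Quot.mk_surjective.countable
  exact hφ.countable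

/-- A compact set meets a discrete subgroup in finitely many points. -/
theorem finite_coe_preimage_of_isCompact {G : Type*} [Group G] [TopologicalSpace G]
    [IsTopologicalGroup G] [T2Space G] (Γ : Subgroup G) [DiscreteTopology Γ] {C : Set G}
    (hC : IsCompact C) : {γ : Γ | (γ : G) ∈ C}.Finite := by
  have hcl : IsClosed (Γ : Set G) := Subgroup.isClosed_of_discrete
  have : IsCompact ((↑) ⁻¹' C : Set Γ) := hcl.isClosedEmbedding_subtypeVal.isCompact_preimage hC
  exact this.finite_of_discrete

/-- A relatively compact Borel set of representatives for the left cosets of `Γ`. -/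
structure IsBoundedTransversal {G : Type*} [Group G] [TopologicalSpace G] [MeasurableSpace G]
    (Γ : Subgroup G) (F : Set G) : Prop where
  measurableSet : MeasurableSet F
  isCompact_closure : IsCompact (closure F)
  exists_mul_mem : ∀ g : G, ∃ γ : Γ, g * γ ∈ F
  eq_of_mul_mem : ∀ g ∈ F, ∀ γ : Γ, g * γ ∈ F → γ = 1

/-! ### Bounded transversals, unimodularity and Hall's condition -/

section Transversal

variable {G : Type*} [Group G] [TopologicalSpace G] [IsTopologicalGroup G]

theorem exists_isOpen_separating [LocallyCompactSpace G] [T2Space G]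
    (Γ : Subgroup G) [DiscreteTopology Γ] :
    ∃ U : Set G, IsOpen U ∧ (1 : G) ∈ U ∧ IsCompact (closure U) ∧
      ∀ g, ∀ x ∈ U, ∀ γ : Γ, g * x * γ ∈ (g * ·) '' U → γ = 1 := by
  obtain ⟨V, hV, hVΓ⟩ : ∃ V : Set G, IsOpen V ∧ ∀ γ : Γ, (γ : G) ∈ V ↔ γ = 1 := by
    have h1 : IsOpen ({1} : Set Γ) := isOpen_discrete _
    obtain ⟨V, hV, h⟩ := isOpen_induced_iff.1 h1
    refine ⟨V, hV, fun γ => ?_⟩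
    change γ ∈ ((↑) ⁻¹' V : Set Γ) ↔ _
    rw [h]; rfl
  have h1V : (1 : G) ∈ V := by simpa using (hVΓ 1).2 rfl
  have hcont : Filter.Tendsto (fun p : G × G => p.1⁻¹ * p.2) (nhds (1, 1)) (nhds 1) := by
    have : Continuous (fun p : G × G => p.1⁻¹ * p.2) := by fun_prop
    simpa using this.tendsto (1, 1)
  have hW := hcont (hV.mem_nhds h1V)
  rw [nhds_prod_eq, Filter.mem_map, Filter.mem_prod_same_iff] at hW
  obtain ⟨W, hW, hWV⟩ := hW
  obtain ⟨K, hK, hKn⟩ := exists_compact_mem_nhds (1 : G)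
  obtain ⟨U, hUs, hU, h1U⟩ := mem_nhds_iff.1 (Filter.inter_mem hW hKn)
  refine ⟨U, hU, h1U, hK.closure_of_subset fun x hx => (hUs hx).2, ?_⟩
  rintro g x hx γ ⟨y, hy, hxy⟩
  have hy' : y = x * γ := by simpa [mul_assoc] using hxy
  refine (hVΓ γ).1 ?_
  have := hWV (Set.mk_mem_prod (hUs hx).1 (hUs hy).1)
  simpa [hy'] using this

/-- Finitely many translates `a U` of a separating open set cover the quotient. They are added one
at a time, each stripped of the cosets already represented. -/
theorem exists_isBoundedTransversal [LocallyCompactSpace G] [T2Space G]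
    [MeasurableSpace G] [BorelSpace G] (Γ : Subgroup G) [DiscreteTopology Γ]
    [CompactSpace (G ⧸ Γ)] : ∃ F : Set G, IsBoundedTransversal Γ F := by
  obtain ⟨U, hU, h1U, hUc, hinj⟩ := exists_isOpen_separating Γ
  have hopen : ∀ g : G, IsOpen ((g * ·) '' U) := fun g => isOpenMap_mul_left g _ hU
  have key : ∀ t : Finset G, ∃ F : Set G, MeasurableSet F ∧ IsCompact (closure F) ∧
      (∀ g : G, (∃ γ : Γ, g * γ ∈ F) ↔ ∃ a ∈ t, ∃ γ : Γ, g * γ ∈ (a * ·) '' U) ∧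
      ∀ g ∈ F, ∀ γ : Γ, g * γ ∈ F → γ = 1 := by
    classical
    intro t
    induction t using Finset.induction_on with
    | empty => exact ⟨∅, by simp⟩
    | insert a t ha ih =>
      obtain ⟨F, hFm, hFc, hFt, hFinj⟩ := ih
      -- `F` is only Borel, but its saturation is that of the open sets `b U`, `b ∈ t`.
      have hS : IsOpen {g : G | ∃ γ : Γ, g * γ ∈ F} := by
        have : {g : G | ∃ γ : Γ, g * γ ∈ F} =
            ⋃ b ∈ t, ⋃ γ : Γ, (· * (γ : G)) ⁻¹' ((b * ·) '' U) := by
          ext g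
          rw [Set.mem_ofPred_eq, hFt]
          simp only [Set.mem_iUnion, Set.mem_preimage, exists_prop]
        rw [this]
        exact isOpen_biUnion fun b _ => isOpen_iUnion fun γ =>
          (hopen b).preimage (continuous_mul_const (γ : G))
      refine ⟨F ∪ ((a * ·) '' U \ {g : G | ∃ γ : Γ, g * γ ∈ F}),
        hFm.union ((hopen a).measurableSet.diff hS.measurableSet), ?_, ?_, ?_⟩
      · have hc : IsCompact ((a * ·) '' closure U) := hUc.image (continuous_const_mul a)
        refine (hFc.union hc).closure_of_subset (Set.union_subset_union subset_closure ?_)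
        exact Set.sdiff_subset.trans (Set.image_mono subset_closure)
      · intro g
        simp only [Finset.exists_mem_insert, ← hFt]
        constructor
        · rintro ⟨γ, h | h⟩
          · exact Or.inr ⟨γ, h⟩
          · exact Or.inl ⟨γ, h.1⟩
        · rintro (⟨γ, h⟩ | ⟨γ, h⟩)
          · by_cases hg : ∃ δ : Γ, g * δ ∈ F
            · exact hg.imp fun _ => Or.inl
            · refine ⟨γ, Or.inr ⟨h, fun ⟨δ, hδ⟩ => hg ⟨γ * δ, ?_⟩⟩⟩
              simpa [mul_assoc] using hδ
          · exact ⟨γ, Or.inl h⟩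
      · rintro g (hg | ⟨hg, hg'⟩) γ (h | ⟨h, h'⟩)
        · exact hFinj g hg γ h
        · exact absurd ⟨γ⁻¹, by simpa using hg⟩ h'
        · exact absurd ⟨γ, h⟩ hg'
        · obtain ⟨x, hx, rfl⟩ := hg
          exact hinj a x hx γ h
  have hcover : ∃ t : Finset G, Set.univ ⊆
      ⋃ a ∈ t, (QuotientGroup.mk : G → G ⧸ Γ) '' ((a * ·) '' U) := by
    refine isCompact_univ.elim_finite_subcover _
      (fun a => QuotientGroup.isOpenMap_coe _ (hopen a)) fun q _ => ?_
    obtain ⟨g, rfl⟩ := QuotientGroup.mk_surjective q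
    exact Set.mem_iUnion.2 ⟨g, g, ⟨1, h1U, mul_one g⟩, rfl⟩
  obtain ⟨t, ht⟩ := hcover
  obtain ⟨F, hFm, hFc, hFt, hFinj⟩ := key t
  refine ⟨F, hFm, hFc, fun g => (hFt g).2 ?_, hFinj⟩
  have := ht (Set.mem_univ (g : G ⧸ Γ))
  simp only [Set.mem_iUnion, exists_prop] at this
  obtain ⟨a, hat, y, hy, hyg⟩ := this
  refine ⟨a, hat, ⟨g⁻¹ * y, QuotientGroup.eq.1 hyg.symm⟩, ?_⟩
  simpa using hy

variable [MeasurableSpace G] {Γ : Subgroup G} {F : Set G}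

omit [IsTopologicalGroup G] in
theorem IsBoundedTransversal.isFundamentalDomain (hF : IsBoundedTransversal Γ F)
    (μ : Measure G) : IsFundamentalDomain Γ.op F μ := by
  refine IsFundamentalDomain.mk' hF.measurableSet.nullMeasurableSet fun x => ?_
  obtain ⟨γ, hγ⟩ := hF.exists_mul_mem x
  refine ⟨Γ.equivOp γ, hγ, fun δ hδ => ?_⟩
  obtain ⟨δ, rfl⟩ := Γ.equivOp.surjective δ
  have h : x * δ ∈ F := hδ
  have := hF.eq_of_mul_mem _ hγ (γ⁻¹ * δ) (by simpa using h)
  rw [inv_mul_eq_one.1 this]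

theorem IsBoundedTransversal.const_mul [BorelSpace G] (hF : IsBoundedTransversal Γ F) (g : G) :
    IsBoundedTransversal Γ ((g * ·) ⁻¹' F) where
  measurableSet := measurable_const_mul g hF.measurableSet
  isCompact_closure := by
    have := (Homeomorph.mulLeft g).preimage_closure F
    simp only [Homeomorph.coe_mulLeft] at this
    rw [← this]
    exact (Homeomorph.mulLeft g).isCompact_preimage.2 hF.isCompact_closure
  exists_mul_mem x := by
    obtain ⟨γ, hγ⟩ := hF.exists_mul_mem (g * x)
    exact ⟨γ, by simpa [mul_assoc] using hγ⟩
  eq_of_mul_mem x hx γ h := hF.eq_of_mul_mem (g * x) hx γ (by simpa [mul_assoc] using h)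

-- A Milnor–Schwarz argument: follow a word in `S`, keeping an element of `Γ` within `K` of each
-- prefix; successive elements differ by a member of the finite set `Γ ∩ C`.
open Pointwise in
theorem IsBoundedTransversal.fg [T2Space G] [DiscreteTopology Γ] (hF : IsBoundedTransversal Γ F)
    (hG : IsCompactlyGeneratedGroup G) : Group.FG Γ := by
  obtain ⟨S, hS, hSG⟩ := hG
  set K := insert 1 (closure F)⁻¹ with hKdef
  have hK : IsCompact K := hF.isCompact_closure.inv.insert 1
  have hKcov : ∀ g : G, ∃ γ : Γ, (γ : G)⁻¹ * g ∈ K := fun g => by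
    obtain ⟨γ, hγ⟩ := hF.exists_mul_mem g⁻¹
    exact ⟨γ, Or.inr (by simpa using subset_closure hγ)⟩
  -- The extra `1` gives `K ⊆ C`, which absorbs the final error `δ⁻¹ * γ`.
  set C := K * insert 1 (S ∪ S⁻¹) * K⁻¹ with hCdef
  have hC : IsCompact C := (hK.mul ((hS.union hS.inv).insert 1)).mul hK.inv
  have hfin := finite_coe_preimage_of_isCompact Γ hC
  set T : Set Γ := {γ : Γ | (γ : G) ∈ C} with hT
  have key : ∀ g ∈ Subgroup.closure S, ∃ γ ∈ Subgroup.closure T, (γ : G)⁻¹ * g ∈ K := by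
    have step : ∀ x y : G, y ∈ S ∪ S⁻¹ → (∃ γ ∈ Subgroup.closure T, (γ : G)⁻¹ * x ∈ K) →
        ∃ γ ∈ Subgroup.closure T, (γ : G)⁻¹ * (x * y) ∈ K := by
      rintro x y hy ⟨γ, hγ, hx⟩
      obtain ⟨δ, hδ⟩ := hKcov ((γ : G)⁻¹ * x * y)
      refine ⟨γ * δ, mul_mem hγ (Subgroup.subset_closure ?_), by simpa [mul_assoc] using hδ⟩
      have := Set.mul_mem_mul (Set.mul_mem_mul hx (Set.mem_insert_of_mem 1 hy))
        (Set.inv_mem_inv.2 hδ)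
      simpa [hT, hCdef, mul_assoc] using this
    intro g hg
    induction hg using Subgroup.closure_induction_right with
    | one => exact ⟨1, one_mem _, by simp [hKdef]⟩
    | mul_right x _ y hy ih => exact step x y (Or.inl hy) ih
    | mul_inv_cancel x _ y hy ih => exact step x y⁻¹ (Or.inr (by simpa using hy)) ih
  refine Group.fg_iff.2 ⟨T, top_unique fun γ _ => ?_, hfin⟩
  obtain ⟨δ, hδ, h⟩ := key γ (hSG ▸ Subgroup.mem_top _)
  have hmem : δ⁻¹ * γ ∈ T := by
    have := Set.mul_mem_mul (Set.mul_mem_mul h (Set.mem_insert 1 (S ∪ S⁻¹)))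
      (Set.inv_mem_inv.2 (show (1 : G) ∈ K from Set.mem_insert _ _))
    rw [mul_one, inv_one, mul_one] at this
    exact this
  simpa using mul_mem hδ (Subgroup.subset_closure hmem)

theorem IsBoundedTransversal.sigmaCompactSpace [Countable Γ] (hF : IsBoundedTransversal Γ F) :
    SigmaCompactSpace G := by
  rw [← isSigmaCompact_univ_iff]
  have h : ⋃ γ : Γ, (· * (γ : G)) '' closure F = Set.univ := by
    refine Set.eq_univ_of_forall fun g => ?_
    obtain ⟨γ, hγ⟩ := hF.exists_mul_mem g
    exact Set.mem_iUnion.2 ⟨γ⁻¹, g * γ, subset_closure hγ, by simp⟩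
  rw [← h]
  exact isSigmaCompact_iUnion_of_isCompact _ fun γ =>
    hF.isCompact_closure.image (continuous_mul_const _)

omit [IsTopologicalGroup G] in
theorem IsBoundedTransversal.measure_ne_top (hF : IsBoundedTransversal Γ F)
    (μ : Measure G) [IsFiniteMeasureOnCompacts μ] : μ F ≠ ⊤ :=
  ((measure_mono subset_closure).trans_lt hF.isCompact_closure.measure_lt_top).ne

/-- A group with a countable subgroup having a relatively compact transversal is unimodular. -/
theorem IsBoundedTransversal.isMulRightInvariant [LocallyCompactSpace G] [BorelSpace G]
    [Countable Γ] (hF : IsBoundedTransversal Γ F) (μ : Measure G) [μ.IsHaarMeasure] :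
    μ.IsMulRightInvariant := by
  have : SigmaCompactSpace G := hF.sigmaCompactSpace
  have : Countable Γ.op := Γ.equivOp.symm.injective.countable
  have hν : μ.inv ≠ 0 := by
    rw [Measure.inv_def, Ne, Measure.map_eq_zero_iff measurable_inv.aemeasurable]
    exact NeZero.ne μ
  have h0 : μ F⁻¹ ≠ 0 := by
    have := (hF.isFundamentalDomain μ.inv).measure_ne_zero hν
    rwa [Measure.inv_apply] at this
  have hc : IsCompact (closure F⁻¹) := by
    rw [← inv_closure]
    exact hF.isCompact_closure.inv
  have htop : μ F⁻¹ ≠ ⊤ := ((measure_mono subset_closure).trans_lt hc.measure_lt_top).ne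
  have hfactor : ∀ g : G, (μ.map (· * g)).haarScalarFactor μ = 1 := by
    intro g
    -- `μ.inv` is right-invariant, so it gives the fundamental domains `F` and `g F` equal mass.
    have h1 : μ.map (· * g) F⁻¹ = μ F⁻¹ := by
      have := ((hF.const_mul g⁻¹).isFundamentalDomain μ.inv).measure_eq
        (hF.isFundamentalDomain μ.inv)
      rw [Measure.inv_apply, Measure.inv_apply] at this
      rw [Measure.map_apply (measurable_mul_const g) hF.measurableSet.inv, ← this]
      congr 1
      ext x
      simp
    have h2 := Measure.measure_isMulInvariant_eq_smul_of_isCompact_closure (μ.map (· * g)) μ hc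
    rw [h1, ENNReal.smul_def, smul_eq_mul] at h2
    have h3 : ((μ.map (· * g)).haarScalarFactor μ : ENNReal) * μ F⁻¹ = 1 * μ F⁻¹ := by
      rw [one_mul, ← h2]
    exact_mod_cast (ENNReal.mul_left_inj h0 htop).1 h3
  refine ⟨fun g => ?_⟩
  -- `μ` need not be regular: uniqueness of Haar measure is applied on relatively compact sets, and
  -- σ-compactness does the rest.
  refine Measure.ext_of_iUnion_eq_univ (iUnion_compactCovering G) fun i => ?_
  ext s hs
  rw [Measure.restrict_apply hs, Measure.restrict_apply hs,
    Measure.measure_isMulInvariant_eq_smul_of_isCompact_closure (μ.map (· * g)) μ, hfactor g,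
    one_smul]
  exact (isCompact_compactCovering G i).closure_of_subset Set.inter_subset_right

theorem IsBoundedTransversal.latticeCovolume_eq [BorelSpace G] [Countable Γ]
    (hF : IsBoundedTransversal Γ F) (μ : Measure G) [μ.IsMulRightInvariant] :
    latticeCovolume Γ μ = μ F := by
  have : Countable Γ.op := Γ.equivOp.symm.injective.countable
  exact (hF.isFundamentalDomain μ).covolume_eq_volume μ

open Pointwise in
/-- Hall's condition for the relation `x⁻¹ * y ∈ F⁻¹ * E` follows from comparing volumes. -/
theorem IsBoundedTransversal.exists_injective [T2Space G] [BorelSpace G] {Λ : Subgroup G}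
    {E : Set G} [DiscreteTopology Λ] (hF : IsBoundedTransversal Γ F)
    (hE : IsBoundedTransversal Λ E) (μ : Measure G) [μ.IsMulRightInvariant]
    [IsFiniteMeasureOnCompacts μ] (h0 : μ F ≠ 0) (hμ : μ F = μ E) :
    ∃ f : Γ → Λ, Function.Injective f ∧ ∀ x : Γ, (x : G)⁻¹ * f x ∈ F⁻¹ * E := by
  classical
  have hfin : ∀ x : Γ, {y : Λ | (x : G)⁻¹ * y ∈ F⁻¹ * E}.Finite := fun x => by
    have hC : IsCompact ((fun z => (x : G) * z) '' ((closure F)⁻¹ * closure E)) :=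
      (hF.isCompact_closure.inv.mul hE.isCompact_closure).image (continuous_const_mul _)
    refine (finite_coe_preimage_of_isCompact Λ hC).subset fun y hy => ?_
    refine ⟨_, Set.mul_subset_mul (Set.inv_subset_inv.2 subset_closure) subset_closure hy, ?_⟩
    simp
  have hall := (Finset.all_card_le_biUnion_card_iff_exists_injective
    fun x : Γ => (hfin x).toFinset).1 ?_
  · obtain ⟨f, hf, h⟩ := hall
    exact ⟨f, hf, fun x : Γ => by simpa using h x⟩
  intro A
  set N := A.biUnion fun x : Γ => (hfin x).toFinset with hN
  have hsub : (⋃ x ∈ A, (· * (x : G)) ⁻¹' F) ⊆ ⋃ y ∈ N, (· * (y : G)) ⁻¹' E := by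
    intro g hg
    simp only [Set.mem_iUnion, Set.mem_preimage, exists_prop] at hg ⊢
    obtain ⟨x, hx, hgx⟩ := hg
    obtain ⟨y, hy⟩ := hE.exists_mul_mem g
    refine ⟨y, Finset.mem_biUnion.2 ⟨x, hx, ?_⟩, hy⟩
    simpa using Set.mul_mem_mul (Set.inv_mem_inv.2 hgx) hy
  have hdisj : (A : Set Γ).PairwiseDisjoint fun x => (· * (x : G)) ⁻¹' F := by
    intro x _ y _ hxy
    refine Set.disjoint_left.2 fun g hgx hgy => hxy ?_
    have := hF.eq_of_mul_mem _ hgx (x⁻¹ * y) (by simpa using hgy)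
    exact inv_mul_eq_one.1 this
  have hle : (A.card : ENNReal) * μ F ≤ N.card * μ F := calc
    (A.card : ENNReal) * μ F = ∑ x ∈ A, μ ((· * (x : G)) ⁻¹' F) := by
      simp [measure_preimage_mul_right]
    _ = μ (⋃ x ∈ A, (· * (x : G)) ⁻¹' F) := (measure_biUnion_finset hdisj fun x _ =>
      measurable_mul_const _ hF.measurableSet).symm
    _ ≤ μ (⋃ y ∈ N, (· * (y : G)) ⁻¹' E) := measure_mono hsub
    _ ≤ ∑ y ∈ N, μ ((· * (y : G)) ⁻¹' E) := measure_biUnion_finset_le _ _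
    _ = N.card * μ F := by simp [measure_preimage_mul_right, hμ]
  exact_mod_cast (ENNReal.mul_le_mul_iff_left h0 (hF.measure_ne_top μ)).1 hle

end Transversal

/-! ### Word metrics and Lipschitz maps -/

section WordMetric

variable {Γ Λ : Type*} [Group Γ] [Group Λ]

theorem mulCayley_connected {S : Set Γ} (hS : Subgroup.closure S = ⊤) :
    (SimpleGraph.mulCayley S).Connected := by
  have step : ∀ x s, s ∈ S → (SimpleGraph.mulCayley S).Reachable x (x * s) := fun x s hs => by
    by_cases h : x = x * s
    · rw [← h]
    · exact SimpleGraph.Adj.reachable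
        ((SimpleGraph.mulCayley_adj' _ _ _).2 ⟨h, s, hs, Or.inl rfl⟩)
  have key : ∀ g, (SimpleGraph.mulCayley S).Reachable 1 g := fun g => by
    have hg : g ∈ Subgroup.closure S := hS ▸ Subgroup.mem_top g
    induction hg using Subgroup.closure_induction_right with
    | one => rfl
    | mul_right x _ y hy ih => exact ih.trans (step x y hy)
    | mul_inv_cancel x _ y hy ih =>
      exact ih.trans (by simpa using (step (x * y⁻¹) y hy).symm)
  exact (SimpleGraph.connected_iff_exists_forall_reachable _).2 ⟨1, key⟩

theorem wordDist_le_wordDist_one {S : Set Γ} (hS : Subgroup.closure S = ⊤) (x y : Γ) :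
    wordDist S x y ≤ wordDist S 1 (x⁻¹ * y) := by
  obtain ⟨p, hp⟩ := (mulCayley_connected hS).exists_walk_length_eq_dist 1 (x⁻¹ * y)
  let φ : SimpleGraph.mulCayley S →g SimpleGraph.mulCayley S :=
    ⟨(x * ·), fun h => SimpleGraph.mulCayley_adj_mul_iff_right.2 h⟩
  have := SimpleGraph.dist_le ((p.map φ).copy (show φ 1 = x from mul_one x)
    (show φ (x⁻¹ * y) = y from mul_inv_cancel_left x y))
  rw [SimpleGraph.Walk.length_copy, SimpleGraph.Walk.length_map, hp] at this
  exact this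

/-- Adjacent points have images at bounded distance; sum along a geodesic. -/
theorem exists_wordDist_le_mul {S : Set Γ} {T : Set Λ} (hS : Subgroup.closure S = ⊤)
    (hT : Subgroup.closure T = ⊤) (f : Γ → Λ) {Q : Set Λ} (hQ : Q.Finite)
    (hf : ∀ x y, (SimpleGraph.mulCayley S).Adj x y → (f x)⁻¹ * f y ∈ Q) :
    ∃ K : ℕ, ∀ x y, wordDist T (f x) (f y) ≤ K * wordDist S x y := by
  obtain ⟨K, hK⟩ := (hQ.image (wordDist T 1)).bddAbove
  refine ⟨K, fun x y => ?_⟩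
  have walk : ∀ {x y : Γ} (p : (SimpleGraph.mulCayley S).Walk x y),
      wordDist T (f x) (f y) ≤ K * p.length := by
    intro x y p
    induction p with
    | nil => simp [wordDist]
    | @cons u v w h p ih =>
      have h1 : wordDist T (f u) (f v) ≤ K :=
        (wordDist_le_wordDist_one hT _ _).trans (hK ⟨_, hf _ _ h, rfl⟩)
      have h2 : wordDist T (f u) (f w) ≤ wordDist T (f u) (f v) + wordDist T (f v) (f w) :=
        (mulCayley_connected hT).dist_triangle
      rw [SimpleGraph.Walk.length_cons]
      linarith
  obtain ⟨p, hp⟩ := (mulCayley_connected hS).exists_walk_length_eq_dist x y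
  have := walk p
  rwa [hp] at this

theorem isBiLipschitzWord_of_le {S : Set Γ} {T : Set Λ} (f : Γ ≃ Λ) {K L : ℕ}
    (hK : ∀ x y, wordDist T (f x) (f y) ≤ K * wordDist S x y)
    (hL : ∀ x y, wordDist S (f.symm x) (f.symm y) ≤ L * wordDist T x y) :
    IsBiLipschitzWord S T f := by
  have hpos : (0 : ℝ) < K + L + 1 := by positivity
  -- The `+ 1` keeps the constant at least `1` even if `K = L = 0`.
  refine ⟨K + L + 1, by linarith [K.cast_nonneg (α := ℝ), L.cast_nonneg (α := ℝ)],
    fun x y => ⟨?_, ?_⟩⟩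
  · rw [inv_mul_le_iff₀ hpos]
    have h : (wordDist S x y : ℝ) ≤ L * wordDist T (f x) (f y) := by
      exact_mod_cast by simpa using hL (f x) (f y)
    refine h.trans ?_
    gcongr
    linarith [K.cast_nonneg (α := ℝ)]
  · have h : (wordDist T (f x) (f y) : ℝ) ≤ K * wordDist S x y := by exact_mod_cast hK x y
    refine h.trans ?_
    gcongr
    linarith [L.cast_nonneg (α := ℝ)]

end WordMetric

open Pointwise in
/-- A map between discrete subgroups at bounded distance from the inclusion is Lipschitz. -/
theorem exists_wordDist_le_mul_of_isCompact {G : Type*} [Group G] [TopologicalSpace G]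
    [IsTopologicalGroup G] [T2Space G] {Γ Λ : Subgroup G} [DiscreteTopology Λ]
    {S : Set Γ} {T : Set Λ} (hSfin : S.Finite) (hS : Subgroup.closure S = ⊤)
    (hT : Subgroup.closure T = ⊤) {C : Set G} (hC : IsCompact C) (f : Γ → Λ)
    (hf : ∀ x : Γ, (x : G)⁻¹ * f x ∈ C) :
    ∃ K : ℕ, ∀ x y, wordDist T (f x) (f y) ≤ K * wordDist S x y := by
  have hS' : IsCompact ((↑) '' (S ∪ S⁻¹) : Set G) :=
    ((hSfin.union hSfin.inv).image _).isCompact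
  refine exists_wordDist_le_mul hS hT f
    (finite_coe_preimage_of_isCompact Λ ((hC.inv.mul hS').mul hC)) fun x y hxy => ?_
  have hmem : x⁻¹ * y ∈ S ∪ S⁻¹ := by
    simpa using ((SimpleGraph.mulCayley_adj _ _ _).1 hxy).2
  have := Set.mul_mem_mul (Set.mul_mem_mul (Set.inv_mem_inv.2 (hf x))
    (Set.mem_image_of_mem ((↑) : Γ → G) hmem)) (hf y)
  have heq : (((f x)⁻¹ * f y : Λ) : G) =
      ((x : G)⁻¹ * f x)⁻¹ * ((x⁻¹ * y : Γ) : G) * ((y : G)⁻¹ * f y) := by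
    push_cast
    group
  rw [Set.mem_ofPred_eq, heq]
  exact this

open Pointwise in
theorem mainTheorem5 {G : Type*} [Group G] [TopologicalSpace G] [IsTopologicalGroup G]
    [T2Space G] [LocallyCompactSpace G] [MeasurableSpace G] [BorelSpace G]
    (hG : IsCompactlyGeneratedGroup G)
    (μ : Measure G) [μ.IsHaarMeasure]
    (Γ₁ Γ₂ : Subgroup G) (h₁ : IsUniformLattice Γ₁) (h₂ : IsUniformLattice Γ₂)
    (hcov : latticeCovolume Γ₁ μ = latticeCovolume Γ₂ μ) :
    AreBiLipschitzEquivalent Γ₁ Γ₂ := by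
  have := h₁.discrete
  have := h₁.cocompact
  have := h₂.discrete
  have := h₂.cocompact
  obtain ⟨F, hF⟩ := exists_isBoundedTransversal Γ₁
  obtain ⟨E, hE⟩ := exists_isBoundedTransversal Γ₂
  have fg₁ : Group.FG Γ₁ := hF.fg hG
  have fg₂ : Group.FG Γ₂ := hE.fg hG
  have : Countable Γ₁ := countable_of_group_fg Γ₁
  have : Countable Γ₂ := countable_of_group_fg Γ₂
  have : Countable Γ₁.op := Γ₁.equivOp.symm.injective.countable
  have := hF.isMulRightInvariant μ
  have hμ : μ F = μ E := by rw [← hF.latticeCovolume_eq μ, hcov, hE.latticeCovolume_eq μ]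
  have h0 : μ F ≠ 0 := (hF.isFundamentalDomain μ).measure_ne_zero (NeZero.ne μ)
  obtain ⟨f, hf, hfm⟩ := hF.exists_injective hE μ h0 hμ
  obtain ⟨g, hg, hgm⟩ := hE.exists_injective hF μ (hμ ▸ h0) hμ.symm
  -- Each value of `b` comes from `f` or from inverting `g`, and both respect the relation since
  -- `(E⁻¹ * F)⁻¹ = F⁻¹ * E`.
  obtain ⟨b, hb, hbm⟩ := Function.Embedding.schroeder_bernstein_of_rel hf hg
    (fun x y => (x : G)⁻¹ * y ∈ F⁻¹ * E) hfm fun y => by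
      simpa [mul_inv_rev] using Set.inv_mem_inv.2 (hgm y)
  refine ⟨fg₁, fg₂, fun S T hSf hTf hS hT => ⟨Equiv.ofBijective b hb, ?_⟩⟩
  set e := Equiv.ofBijective b hb with he
  have hC : IsCompact ((closure F)⁻¹ * closure E) :=
    hF.isCompact_closure.inv.mul hE.isCompact_closure
  have hsub : F⁻¹ * E ⊆ (closure F)⁻¹ * closure E :=
    Set.mul_subset_mul (Set.inv_subset_inv.2 subset_closure) subset_closure
  obtain ⟨K, hK⟩ := exists_wordDist_le_mul_of_isCompact hSf hS hT hC e fun x : Γ₁ => hsub (hbm x)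
  obtain ⟨L, hL⟩ := exists_wordDist_le_mul_of_isCompact hTf hT hS hC.inv e.symm fun y : Γ₂ => by
    have : ((e.symm y : Γ₁) : G)⁻¹ * (e (e.symm y) : Γ₂) ∈ F⁻¹ * E := hbm (e.symm y)
    rw [e.apply_symm_apply] at this
    rw [Set.mem_inv]
    simpa using hsub this
  exact isBiLipschitzWord_of_le e hK hL
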